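/- Let $\mathfrak{a}$ be one of the complex Lie algebras $\mathfrak{o}_{2n+1}$ ($n\ge 1$), $\mathfrak{sp}_{2n}$ ($n\ge 1$) or $\mathfrak{o}_{2n}$ ($n\ge 2$), and put $N=2n+1$, $2n$, $2n$ respectively. Rows and columns of $N\times N$ matrices are indexed by the integers $-n,\dots,n$, where $0$ is skipped if $N=2n$. Put $\theta_{ij}=1$ and $\kappa=N/2-1$ in the orthogonal cases, and $\theta_{ij}=\operatorname{sgn}i\cdot\operatorname{sgn}j$ and $\kappa=N/2+1$ in the symplectic case. The extended Yangian $\mathrm{X}(\mathfrak{a})$ is the associative unital $\mathbb{C}$-algebra with generators $t_{ij}^{(r)}$ ($r\ge 1$) and defining relations, for all indices $i,j,k,l$, $$[t_{ij}(u),t_{kl}(v)]=\frac{1}{u-v}\Big(t_{kj}(u)t_{il}(v)-t_{kj}(v)t_{il}(u)\Big)-\frac{1}{u-v-\kappa}\Big(\delta_{k,-i}\sum_{p}\theta_{ip}\,t_{pj}(u)t_{-p,l}(v)-\delta_{l,-j}\sum_{p}\theta_{jp}\,t_{k,-p}(v)t_{ip}(u)\Big),$$ where $t_{ij}(u)=\delta_{ij}+\sum_{r\ge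 1}t_{ij}^{(r)}u^{-r}$. A vector $\xi$ of an $\mathrm{X}(\mathfrak{a})$-module $V$ is called a highest vector of $V$ if $\xi\neq 0$, $\xi$ generates $V$, $t_{ij}(u)\,\xi=0$ for all $i<j$, and $t_{ii}(u)\,\xi=\lambda_i(u)\,\xi$ for all $i$, for some formal series $\lambda_i(u)\in 1+u^{-1}\mathbb{C}[[u^{-1}]]$. The module $V$ is called a highest weight representation if it has a highest vector. Theorem. Every finite-dimensional irreducible representation $V$ of the algebra $\mathrm{X}(\mathfrak{a})$ is a highest weight representation. Moreover, $V$ contains a unique, up to a nonzero constant factor, highest vector. -/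

import Mathlib

noncomputable section

namespace ExtYangian

/-- The three families of classical Lie algebras: `B` stands for `o_{2n+1}`,
`C` for `sp_{2n}`, and `D` for `o_{2n}`. -/
inductive ClassicalType
  | B
  | C
  | D
  deriving DecidableEq

/-- The ranks considered: `o_{2n+1}` and `sp_{2n}` for `n ≥ 1`, and `o_{2n}` for `n ≥ 2`
(so the orthogonal Lie algebras are the `o_N` with `N ≥ 3`). -/
def ClassicalType.Admissible : ClassicalType → ℕ → Prop
  | .B, n => 1 ≤ n
  | .C, n => 1 ≤ n
  | .D, n => 2 ≤ n

/-- The size `N` of the matrices. -/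
def ClassicalType.size : ClassicalType → ℕ → ℕ
  | .B, n => 2 * n + 1
  | .C, n => 2 * n
  | .D, n => 2 * n

/-- `κ = N/2 - 1` in the orthogonal case and `κ = N/2 + 1` in the symplectic case. -/
def ClassicalType.kappa (X : ClassicalType) (n : ℕ) : ℂ :=
  match X with
  | .B => (X.size n : ℂ) / 2 - 1
  | .C => (X.size n : ℂ) / 2 + 1
  | .D => (X.size n : ℂ) / 2 - 1

/-- The set of row and column indices: `-n, …, n`, where `0` is skipped unless `N = 2n + 1`. -/
def indexSet (X : ClassicalType) (n : ℕ) : Finset ℤ :=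
  (Finset.Icc (-(n : ℤ)) (n : ℤ)).filter fun i => i = 0 → X = ClassicalType.B

/-- The type of row and column indices, ordered as integers. -/
abbrev Idx (X : ClassicalType) (n : ℕ) : Type := {i : ℤ // i ∈ indexSet X n}

theorem neg_mem_indexSet {X : ClassicalType} {n : ℕ} {i : ℤ} (hi : i ∈ indexSet X n) :
    -i ∈ indexSet X n := by
  simp only [indexSet, Finset.mem_filter, Finset.mem_Icc] at hi ⊢
  refine ⟨⟨by omega, by omega⟩, fun h => hi.2 (by omega)⟩

instance (X : ClassicalType) (n : ℕ) : Neg (Idx X n) :=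
  ⟨fun i => ⟨-i.1, neg_mem_indexSet i.2⟩⟩

/-- `θ_{ij}`: equal to `1` in the orthogonal case and to `sgn i · sgn j` in the symplectic case. -/
def theta (X : ClassicalType) {n : ℕ} (i j : Idx X n) : ℂ :=
  match X with
  | .B => 1
  | .C => ((Int.sign i.1 * Int.sign j.1 : ℤ) : ℂ)
  | .D => 1

/-- The free algebra on the generators `t_{ij}^{(r)}`, `r ≥ 1`; the triple `(i, j, m)` is the
label of `t_{ij}^{(m+1)}`. -/
abbrev Free (X : ClassicalType) (n : ℕ) : Type :=
  FreeAlgebra ℂ (Idx X n × Idx X n × ℕ)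

/-- The coefficient of `u^{-r}` in the formal series
`t_{ij}(u) = δ_{ij} + t_{ij}^{(1)} u^{-1} + t_{ij}^{(2)} u^{-2} + ⋯`, for any integer `r`. -/
def freeT {X : ClassicalType} {n : ℕ} (i j : Idx X n) : ℤ → Free X n
  | .ofNat 0 => if i = j then 1 else 0
  | .ofNat (m + 1) => FreeAlgebra.ι ℂ (i, j, m)
  | .negSucc _ => 0

/-- If `F r s` is the coefficient of `u^{-r} v^{-s}` in a formal Laurent series `F(u, v)` in
`u⁻¹, v⁻¹`, then `mulDiff c F r s` is its coefficient in `(u - v - c) F(u, v)`. -/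
def mulDiff {A : Type*} [Ring A] [Algebra ℂ A] (c : ℂ) (F : ℤ → ℤ → A) (r s : ℤ) : A :=
  F (r + 1) s - F r (s + 1) - c • F r s

/-- The coefficients of `[t_{ij}(u), t_{kl}(v)]`. -/
def commCoeff {X : ClassicalType} {n : ℕ} (i j k l : Idx X n) (r s : ℤ) : Free X n :=
  freeT i j r * freeT k l s - freeT k l s * freeT i j r

/-- The coefficients of `t_{kj}(u) t_{il}(v) - t_{kj}(v) t_{il}(u)`. -/
def permCoeff {X : ClassicalType} {n : ℕ} (i j k l : Idx X n) (r s : ℤ) : Free X n :=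
  freeT k j r * freeT i l s - freeT k j s * freeT i l r

/-- The coefficients of
`δ_{k,-i} ∑_p θ_{ip} t_{pj}(u) t_{-p,l}(v) - δ_{l,-j} ∑_p θ_{jp} t_{k,-p}(v) t_{ip}(u)`. -/
def contrCoeff {X : ClassicalType} {n : ℕ} (i j k l : Idx X n) (r s : ℤ) : Free X n :=
  (if k = -i then ∑ p : Idx X n, theta X i p • (freeT p j r * freeT (-p) l s) else 0) -
  (if l = -j then ∑ p : Idx X n, theta X j p • (freeT k (-p) s * freeT i p r) else 0)

/-- The defining relations of the extended Yangian. With `D = u - v`, these are all the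
coefficients of the entries
`D (D - κ) [t_{ij}(u), t_{kl}(v)] = (D - κ) (t_{kj}(u) t_{il}(v) - t_{kj}(v) t_{il}(u))
  - D (δ_{k,-i} ∑_p θ_{ip} t_{pj}(u) t_{-p,l}(v) - δ_{l,-j} ∑_p θ_{jp} t_{k,-p}(v) t_{ip}(u))`
of the matrix relation `R(u - v) T₁(u) T₂(v) = T₂(v) T₁(u) R(u - v)` with
`R(u) = 1 - P/u + Q/(u - κ)`, multiplied by the denominators `D (D - κ)`. -/
inductive Rel (X : ClassicalType) (n : ℕ) : Free X n → Free X n → Prop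
  | rtt (i j k l : Idx X n) (r s : ℤ) :
      Rel X n
        (mulDiff 0 (mulDiff (X.kappa n) (commCoeff i j k l)) r s)
        (mulDiff (X.kappa n) (permCoeff i j k l) r s - mulDiff 0 (contrCoeff i j k l) r s)

/-- The extended Yangian `X(𝔞)` as an associative unital algebra over `ℂ`. -/
abbrev ExtendedYangian (X : ClassicalType) (n : ℕ) : Type := RingQuot (Rel X n)

/-- The element `t_{ij}^{(r)}` of the extended Yangian, `r ≥ 0`, with `t_{ij}^{(0)} = δ_{ij}`. -/
def t {X : ClassicalType} {n : ℕ} (i j : Idx X n) (r : ℕ) : ExtendedYangian X n :=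
  RingQuot.mkAlgHom ℂ (Rel X n) (freeT i j (r : ℤ))

variable {X : ClassicalType} {n : ℕ} {V : Type*} [AddCommGroup V] [Module ℂ V]
  [Module (ExtendedYangian X n) V]

/-- `ξ` is a highest vector of the representation `V` of highest weight
`λ(u) = (λ_i(u))_i`, a tuple of formal power series in `u⁻¹` with constant term `1`:
`ξ` is nonzero and generates `V`, `t_{ij}(u) ξ = 0` for `i < j`, and
`t_{ii}(u) ξ = λ_i(u) ξ` for all `i`. -/
structure IsHighestVectorOfWeight (lam : Idx X n → PowerSeries ℂ) (ξ : V) : Prop where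
  constantCoeff_eq_one : ∀ i, PowerSeries.constantCoeff (lam i) = 1
  ne_zero : ξ ≠ 0
  generates : Submodule.span (ExtendedYangian X n) {ξ} = ⊤
  raising : ∀ (i j : Idx X n), i < j → ∀ r : ℕ, t i j r • ξ = 0
  diagonal : ∀ (i : Idx X n) (r : ℕ), t i i r • ξ = (PowerSeries.coeff r (lam i)) • ξ

variable (X n) in
/-- `ξ` is a highest vector of the representation `V`, of some highest weight. -/
def IsHighestVector (ξ : V) : Prop :=
  ∃ lam : Idx X n → PowerSeries ℂ, IsHighestVectorOfWeight lam ξ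

variable (X n V) in
/-- `V` is a highest weight representation of the extended Yangian. -/
def IsHighestWeightModule : Prop := ∃ ξ : V, IsHighestVector X n ξ

end ExtYangian

end

/-! Existence. A combination of the `t i i 1` grades the module so that `t_{kl}(u)` has degree `l -
k`. In finite dimension, the eigenspace of this operator whose eigenvalue has maximal real part is
killed by every `t_{ij}(u)` with `i < j`. On vectors so killed the diagonal coefficients commute
(`IsVacuum.comm_diagonal_eq_zero`), so they have a common eigenvector there, and it generates the
module by irreducibility.

Uniqueness. The algebra is commutative up to terms of lower degree (`comm_mem_pairSpan`), so a
module generated by a highest vector `ξ` of degree `μ` is spanned by `ξ` and words in lowering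
coefficients applied to it. Hence its degrees are `μ - m` with `m` a natural number, and degree `μ`
occurs only on the line of `ξ`. For two highest vectors each degree is thus below the other, so they
are equal and the vectors are proportional. -/

noncomputable section

namespace ExtYangian

/-! ### Cancelling factors `u - v - c` from formal series. -/

section Difference

variable {M : Type*} [AddCommGroup M] [Module ℂ M]

/-- Multiplication of a formal series in `u⁻¹, v⁻¹` with coefficients in `M` by `u - v`. -/
def diff : Module.End ℂ (ℤ → ℤ → M) where
  toFun F r s := F (r + 1) s - F r (s + 1)
  map_add' F G := by ext r s; simp only [Pi.add_apply]; abel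
  map_smul' c F := by ext r s; simp [smul_sub]

theorem diff_apply (F : ℤ → ℤ → M) (r s : ℤ) : diff F r s = F (r + 1) s - F r (s + 1) := rfl

theorem diff_map {M' : Type*} [AddCommGroup M'] [Module ℂ M'] (f : M →ₗ[ℂ] M')
    (F : ℤ → ℤ → M) : diff (fun r s => f (F r s)) = fun r s => f (diff F r s) := by
  ext r s
  simp [diff_apply]

theorem mulDiff_eq {A : Type*} [Ring A] [Algebra ℂ A] (c : ℂ) (F : ℤ → ℤ → A) :
    mulDiff c F = diff F - c • F := rfl

/-- A filtered form of the invertibility of `u - v - c`. -/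
theorem mem_of_diff_sub_smul_mem {c : ℂ} {F : ℤ → ℤ → M} {S : ℤ → Submodule ℂ M}
    (hS : Monotone S) {a : ℤ} (hF : ∀ r s, r ≤ a → F r s = 0)
    (h : ∀ r s, (diff F - c • F) r s ∈ S (r + s + 1)) (r s : ℤ) : F r s ∈ S (r + s) := by
  rcases le_total r a with hr | hr
  · rw [hF r s hr]; exact zero_mem _
  · revert s
    induction r, hr using Int.leInduction with
    | base => intro s; rw [hF a s le_rfl]; exact zero_mem _
    | succ r _ ih =>
      intro s
      have h1 := h r s
      have h2 := ih (s + 1)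
      have h3 : c • F r s ∈ S (r + s + 1) := hS (by omega) ((S _).smul_mem c (ih s))
      rw [← add_assoc] at h2
      have : F (r + 1) s = (diff F - c • F) r s + F r (s + 1) + c • F r s := by
        simp only [Pi.sub_apply, Pi.smul_apply, diff_apply]; abel
      rw [this, show r + 1 + s = r + s + 1 by ring]
      exact add_mem (add_mem h1 h2) h3

/-- The vanishing for small `r` is essential: on arrays infinite in both directions `u - v - c` has
a kernel, for instance the formal delta function when `c = 0`. -/
theorem eq_zero_of_diff_eq_smul {c : ℂ} {F : ℤ → ℤ → M} {a : ℤ}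
    (hF : ∀ r s, r ≤ a → F r s = 0) (h : diff F = c • F) : F = 0 := by
  ext r s
  have := mem_of_diff_sub_smul_mem (c := c) (S := fun _ => (⊥ : Submodule ℂ M))
    (fun _ _ _ => le_rfl) hF (fun r s => by simp [h]) r s
  simpa using this

theorem diff_eq_zero_of_le {F : ℤ → ℤ → M} {a : ℤ} (hF : ∀ r s, r ≤ a → F r s = 0) (r s : ℤ)
    (hr : r ≤ a - 1) : diff F r s = 0 := by
  rw [diff_apply, hF _ _ (by omega), hF _ _ (by omega), sub_zero]

theorem eq_zero_of_diff_diff_eq {b c : ℂ} {F : ℤ → ℤ → M} {a : ℤ}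
    (hF : ∀ r s, r ≤ a → F r s = 0) (h : diff (diff F) = (b + c) • diff F - (b * c) • F) :
    F = 0 := by
  refine eq_zero_of_diff_eq_smul (c := c) hF (sub_eq_zero.mp ?_)
  refine eq_zero_of_diff_eq_smul (c := b) (a := a - 1) (fun r s hr => ?_) ?_
  · rw [Pi.sub_apply, Pi.sub_apply, diff_eq_zero_of_le hF r s hr, Pi.smul_apply, Pi.smul_apply,
      hF r s (by omega), smul_zero, sub_zero]
  · rw [map_sub, map_smul, h]; module

end Difference

/-! ### Signs. -/

section Theta

variable {X : ClassicalType} {n : ℕ}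

@[simp] theorem coe_neg_idx (i : Idx X n) : ((-i : Idx X n) : ℤ) = -(i : ℤ) := rfl

@[simp] theorem neg_neg_idx (i : Idx X n) : - -i = i := Subtype.ext (neg_neg i.1)

theorem theta_mul_theta (i j k : Idx X n) : theta X i j * theta X j k = theta X i k := by
  have hj := j.2
  simp only [indexSet, Finset.mem_filter] at hj
  cases X <;> simp only [theta, mul_one]
  have h0 : j.1 ≠ 0 := fun h => by simpa using hj.2 h
  have : Int.sign j.1 * Int.sign j.1 = 1 := by
    rw [← Int.sign_mul, Int.sign_eq_one_iff_pos]; exact mul_self_pos.mpr h0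
  rw [← Int.cast_mul]
  congr 1
  calc _ = Int.sign i.1 * (Int.sign j.1 * Int.sign j.1) * Int.sign k.1 := by ring
    _ = _ := by rw [this, mul_one]

theorem theta_comm (i j : Idx X n) : theta X i j = theta X j i := by
  cases X <;> simp [theta, mul_comm]

theorem theta_self (i : Idx X n) : theta X i i = 1 := by
  have hi := i.2
  simp only [indexSet, Finset.mem_filter] at hi
  cases X <;> simp only [theta]
  have h0 : i.1 ≠ 0 := fun h => by simpa using hi.2 h
  rw [← Int.sign_mul, Int.sign_eq_one_iff_pos.mpr (mul_self_pos.mpr h0), Int.cast_one]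

theorem theta_mul_self (i j : Idx X n) : theta X i j * theta X i j = 1 := by
  rw [theta_comm i j, theta_comm j i, ← theta_self i]
  nth_rw 2 [theta_comm]
  exact theta_mul_theta i j i

end Theta

/-! ### The defining relations as identities between arrays of vectors. -/

section Operators

variable (X : ClassicalType) {n : ℕ} (V : Type*) [AddCommGroup V] [Module ℂ V]
  [Module (ExtendedYangian X n) V] [IsScalarTower ℂ (ExtendedYangian X n) V]

/-- The action of the coefficient of `u^{-r}` in `t_{ij}(u)` on a representation. -/
def op (i j : Idx X n) (r : ℤ) : Module.End ℂ V :=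
  letI := IsScalarTower.to_smulCommClass (R := ℂ) (A := ExtendedYangian X n) (M := V)
  Algebra.lsmul ℂ ℂ V (RingQuot.mkAlgHom ℂ (Rel X n) (freeT i j r))

variable {X V}

theorem op_apply (i j : Idx X n) (r : ℤ) (v : V) :
    op X V i j r v = RingQuot.mkAlgHom ℂ (Rel X n) (freeT i j r) • v := rfl

theorem t_smul (i j : Idx X n) (r : ℕ) (v : V) : t i j r • v = op X V i j r v := rfl

theorem op_of_neg (i j : Idx X n) {r : ℤ} (hr : r < 0) : op X V i j r = 0 := by
  ext v
  obtain ⟨m, rfl⟩ := Int.eq_negSucc_of_lt_zero hr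
  simp [op_apply, freeT]

theorem op_zero (i j : Idx X n) (v : V) : op X V i j 0 v = if i = j then v else 0 := by
  rw [op_apply]
  change RingQuot.mkAlgHom ℂ (Rel X n) (if i = j then 1 else 0) • v = _
  split_ifs <;> simp

/-- The coefficients of `[t_{ij}(u), t_{kl}(v)] e`. -/
def comm (i j k l : Idx X n) (e : V) (r s : ℤ) : V :=
  op X V i j r (op X V k l s e) - op X V k l s (op X V i j r e)

/-- The coefficients of `(t_{kj}(u) t_{il}(v) - t_{kj}(v) t_{il}(u)) e`. -/
def perm (i j k l : Idx X n) (e : V) (r s : ℤ) : V :=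
  op X V k j r (op X V i l s e) - op X V k j s (op X V i l r e)

/-- The coefficients of `∑_p θ_{ip} t_{pj}(u) t_{-p,l}(v) e`. -/
def contrLeft (i j l : Idx X n) (e : V) (r s : ℤ) : V :=
  ∑ p : Idx X n, theta X i p • op X V p j r (op X V (-p) l s e)

/-- The coefficients of `∑_p θ_{jp} t_{k,-p}(v) t_{ip}(u) e`. -/
def contrRight (j i k : Idx X n) (e : V) (r s : ℤ) : V :=
  ∑ p : Idx X n, theta X j p • op X V k (-p) s (op X V i p r e)

/-- The defining relations applied to a vector. -/
theorem diff_diff_comm (i j k l : Idx X n) (e : V) :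
    diff (diff (comm i j k l e)) - X.kappa n • diff (comm i j k l e) =
      diff (perm i j k l e) - X.kappa n • perm i j k l e -
        diff ((if k = -i then contrLeft i j l e else 0) -
          (if l = -j then contrRight j i k e else 0)) := by
  let φ : Free X n →ₗ[ℂ] V :=
    (LinearMap.toSpanSingleton (ExtendedYangian X n) V e).restrictScalars ℂ ∘ₗ
      (RingQuot.mkAlgHom ℂ (Rel X n)).toLinearMap
  have hφ : ∀ x, φ x = RingQuot.mkAlgHom ℂ (Rel X n) x • e := fun x => rfl
  have hC : (fun r s => φ (commCoeff i j k l r s)) = comm i j k l e := by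
    ext r s
    simp [hφ, commCoeff, comm, op_apply, sub_smul, mul_smul]
  have hP : (fun r s => φ (permCoeff i j k l r s)) = perm i j k l e := by
    ext r s
    simp [hφ, permCoeff, perm, op_apply, sub_smul, mul_smul]
  have hQ : (fun r s => φ (contrCoeff i j k l r s)) =
      ((if k = -i then contrLeft i j l e else 0) -
          (if l = -j then contrRight j i k e else 0)) := by
    ext r s
    rw [contrCoeff, map_sub, Pi.sub_apply, Pi.sub_apply]
    congr 1
    · split_ifs
      · simp [hφ, contrLeft, op_apply, Finset.sum_smul, mul_smul]
      · simp
    · split_ifs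
      · simp [hφ, contrRight, op_apply, Finset.sum_smul, mul_smul]
      · simp
  rw [← hC, ← hP, ← hQ]
  simp only [diff_map]
  ext r s
  have h := RingQuot.mkAlgHom_rel ℂ (Rel.rtt i j k l r s)
  replace h := congrArg (· • e) h
  change φ _ = φ _ at h
  simpa only [mulDiff_eq, zero_smul, map_sub, map_smul, Pi.sub_apply, Pi.smul_apply,
    Pi.zero_apply, map_zero, sub_zero] using h

theorem comm_of_nonpos (i j k l : Idx X n) (e : V) (r s : ℤ) (hr : r ≤ 0) :
    comm i j k l e r s = 0 := by
  rcases hr.lt_or_eq with hr | rfl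
  · simp [comm, op_of_neg _ _ hr]
  · simp only [comm, op_zero]
    split_ifs <;> simp

theorem comm_swap (i j k l : Idx X n) (e : V) (r s : ℤ) :
    comm i j k l e r s = -comm k l i j e s r := by
  simp [comm]

theorem contrLeft_of_neg (i j l : Idx X n) (e : V) (r s : ℤ) (hr : r ≤ -1) :
    contrLeft i j l e r s = 0 := by
  simp [contrLeft, op_of_neg _ _ (show r < 0 by omega)]

theorem contrRight_of_neg (i j l : Idx X n) (e : V) (r s : ℤ) (hr : r ≤ -1) :
    contrRight i j l e r s = 0 := by
  simp [contrRight, op_of_neg _ _ (show r < 0 by omega)]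

theorem perm_of_neg (i j k l : Idx X n) (e : V) (r s : ℤ) (hr : r ≤ -1) :
    perm i j k l e r s = 0 := by
  simp [perm, op_of_neg _ _ (show r < 0 by omega)]

end Operators

/-! ### The principal grading, and commutation of the diagonal series on vacuum vectors. -/

section Vacuum

variable {X : ClassicalType} {n : ℕ} {V : Type*} [AddCommGroup V] [Module ℂ V]
  [Module (ExtendedYangian X n) V] [IsScalarTower ℂ (ExtendedYangian X n) V]

/-- The relation at `r = -1`: only the leading term of `(u - v)(u - v - κ)` survives, and on the
right `u` enters only through the constant terms `δ`. -/
theorem comm_one (i j k l : Idx X n) (e : V) (s : ℤ) :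
    comm i j k l e 1 s =
      (if k = j then op X V i l s e else 0) - (if i = l then op X V k j s e else 0) -
        ((if k = -i then theta X i j • op X V (-j) l s e else 0) -
          (if l = -j then theta X j i • op X V k (-i) s e else 0)) := by
  have h := congrFun (congrFun (diff_diff_comm i j k l e) (-1)) s
  have hl : contrLeft i j l e 0 s = theta X i j • op X V (-j) l s e := by
    simp [contrLeft, op_zero]
  have hr : contrRight j i k e 0 s = theta X j i • op X V k (-i) s e := by
    simp [contrRight, op_zero, apply_ite (op X V k _ s)]
  have hp : perm i j k l e 0 s =
      (if k = j then op X V i l s e else 0) - (if i = l then op X V k j s e else 0) := by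
    simp [perm, op_zero, apply_ite (op X V k j s)]
  rw [← hl, ← hr, ← hp]
  have h1 : ∀ s, contrLeft i j l e (-1) s = 0 := fun s => contrLeft_of_neg _ _ _ _ _ _ le_rfl
  have h2 : ∀ s, contrRight j i k e (-1) s = 0 := fun s => contrRight_of_neg _ _ _ _ _ _ le_rfl
  have h3 : ∀ s, perm i j k l e (-1) s = 0 := fun s => perm_of_neg _ _ _ _ _ _ _ le_rfl
  have h4 : ∀ s, comm i j k l e (-1) s = 0 := fun s => comm_of_nonpos _ _ _ _ _ _ _ (by simp)
  have h5 : ∀ s, comm i j k l e 0 s = 0 := fun s => comm_of_nonpos _ _ _ _ _ _ _ le_rfl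
  simp only [Pi.sub_apply, Pi.smul_apply, diff_apply, neg_add_cancel, zero_add, h3, h4, h5,
    smul_zero, sub_zero, ite_apply, Pi.zero_apply, h1, h2, ite_self] at h
  exact h

variable (X n V) in
/-- The element defining the principal grading: `t_{kl}(u)` has degree `l - k`. -/
def grading : Module.End ℂ V := ∑ i : Idx X n, (-((i : ℤ) : ℂ) / 2) • op X V i i 1

theorem grading_op (k l : Idx X n) (s : ℤ) (e : V) :
    grading X n V (op X V k l s e) =
      op X V k l s (grading X n V e) + (((l : ℤ) : ℂ) - ((k : ℤ) : ℂ)) • op X V k l s e := by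
  rw [← sub_eq_iff_eq_add']
  -- The indices `i` and `-i` contribute equally to the weighted sum, which is why `grading` carries
  -- the factor `1/2`.
  have h : ∀ i : Idx X n, comm i i k l e 1 s =
      (((if i = k then 1 else 0) - (if i = l then 1 else 0)) -
        ((if i = -k then 1 else 0) - (if i = -l then 1 else 0)) : ℂ) • op X V k l s e := by
    intro i
    have e1 : ∀ k : Idx X n, k = -i ↔ i = -k := fun k =>
      ⟨fun h => by rw [h, neg_neg_idx], fun h => by rw [h, neg_neg_idx]⟩
    simp only [comm_one, theta_self, one_smul, sub_smul, ite_smul, zero_smul, e1 k, e1 l, eq_comm (a := k)]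
    clear e1
    congr 1 <;> congr 1 <;> split_ifs with h <;> simp_all
  have : grading X n V (op X V k l s e) - op X V k l s (grading X n V e) =
      ∑ i : Idx X n, (-((i : ℤ) : ℂ) / 2) • comm i i k l e 1 s := by
    simp [grading, comm, smul_sub]
  rw [this]
  simp_rw [h, smul_smul]
  rw [← Finset.sum_smul]
  congr 1
  simp only [mul_sub, mul_ite, mul_one, mul_zero, Finset.sum_sub_distrib, Finset.sum_ite_eq',
    Finset.mem_univ, if_true, coe_neg_idx, Int.cast_neg]
  ring

theorem grading_op_of_eigen {μ : ℂ} {e : V} (he : grading X n V e = μ • e) (k l : Idx X n)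
    (s : ℤ) : grading X n V (op X V k l s e) =
      (μ + (((l : ℤ) : ℂ) - ((k : ℤ) : ℂ))) • op X V k l s e := by
  rw [grading_op, he, map_smul, add_smul]

theorem contrLeft_eq_theta_smul (i k j l : Idx X n) (e : V) :
    contrLeft i j l e = theta X i k • contrLeft k j l e := by
  ext r s
  simp only [contrLeft, Pi.smul_apply, Finset.smul_sum, smul_smul, theta_mul_theta]

theorem contrRight_eq_theta_smul (i k j l : Idx X n) (e : V) :
    contrRight i j l e = theta X i k • contrRight k j l e := by
  ext r s
  simp only [contrRight, Pi.smul_apply, Finset.smul_sum, smul_smul, theta_mul_theta]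

/-- The coefficients of
`∑_p θ_{jp} t_{pj}(u) t_{-p,-j}(v) e - ∑_p θ_{ip} t_{-i,-p}(v) t_{ip}(u) e`. -/
def contrDiff (j i : Idx X n) (e : V) : ℤ → ℤ → V :=
  contrLeft j j (-j) e - contrRight i i (-i) e

theorem contrDiff_of_neg (j i : Idx X n) (e : V) (r s : ℤ) (hr : r ≤ -1) :
    contrDiff j i e r s = 0 := by
  simp [contrDiff, contrLeft_of_neg _ _ _ _ _ _ hr, contrRight_of_neg _ _ _ _ _ _ hr]

theorem diff_diff_comm_neg (i j : Idx X n) (e : V) :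
    diff (diff (comm i j (-i) (-j) e)) - X.kappa n • diff (comm i j (-i) (-j) e) =
      diff (perm i j (-i) (-j) e) - X.kappa n • perm i j (-i) (-j) e -
        theta X i j • diff (contrDiff j i e) := by
  rw [diff_diff_comm, if_pos rfl, if_pos rfl, contrLeft_eq_theta_smul i j,
    contrRight_eq_theta_smul j i, theta_comm j i, ← smul_sub, map_smul, contrDiff]

/-- Without the permutation term, both sides of the relation carry a factor `u - v`, which cancels.
-/
theorem diff_comm_neg {i j : Idx X n} {e : V} (h : perm i j (-i) (-j) e = 0) :
    diff (comm i j (-i) (-j) e) - X.kappa n • comm i j (-i) (-j) e =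
      -theta X i j • contrDiff j i e := by
  rw [← sub_eq_zero]
  refine eq_zero_of_diff_eq_smul (c := 0) (a := -1) (fun r s hr => ?_) ?_
  · have h1 : ∀ s, comm i j (-i) (-j) e r s = 0 := fun s =>
      comm_of_nonpos _ _ _ _ _ _ _ (by omega)
    have h2 : ∀ s, comm i j (-i) (-j) e (r + 1) s = 0 := fun s =>
      comm_of_nonpos _ _ _ _ _ _ _ (by omega)
    simp [diff_apply, h1, h2, contrDiff_of_neg _ _ _ _ _ hr]
  · have := diff_diff_comm_neg i j e
    rw [h] at this
    rw [map_sub, map_sub, map_smul, map_smul, this]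
    simp

variable (X n) in
/-- The vector `e` is annihilated by all `t_{ij}(u)` with `i < j`. -/
def IsVacuum (e : V) : Prop := ∀ i j : Idx X n, i < j → ∀ r : ℤ, op X V i j r e = 0

theorem neg_lt_neg_idx {i j : Idx X n} : -i < -j ↔ j < i := by
  simp only [← Subtype.coe_lt_coe, coe_neg_idx, neg_lt_neg_iff]

variable {e : V}

theorem IsVacuum.perm_eq_zero (he : IsVacuum X n e) {i l : Idx X n} (h : i < l)
    (j k : Idx X n) : perm i j k l e = 0 := by
  ext r s
  simp [perm, he i l h]

/-- Terms with `q > i` die on a vacuum vector. For `q < i` each product equals a commutator whose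
other half dies on `e`. -/
theorem IsVacuum.contrDiff_self (he : IsVacuum X n e) (i : Idx X n) :
    contrDiff i i e = comm i i (-i) (-i) e +
      ∑ q with q < i, theta X i q • (comm q i (-q) (-i) e + comm i q (-i) (-q) e) := by
  have h1 : comm i i (-i) (-i) e = ∑ q, if q = i then comm i i (-i) (-i) e else 0 := by simp
  rw [h1, Finset.sum_filter, ← Finset.sum_add_distrib]
  ext r s
  simp only [contrDiff, contrLeft, contrRight, Pi.sub_apply, ← Finset.sum_sub_distrib,
    Finset.sum_apply, ← smul_sub]
  refine Finset.sum_congr rfl fun q _ => ?_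
  rcases lt_trichotomy q i with h | rfl | h
  · have h2 := he (-i) (-q) (neg_lt_neg_idx.mpr h)
    simp [h.ne, h, comm, he q i h, h2, sub_eq_add_neg]
  · simp [theta_self, comm]
  · have h2 := he (-q) (-i) (neg_lt_neg_idx.mpr h)
    simp [h.ne', h.not_gt, he i q h, h2]

/-- Each of the `q < i` in `contrDiff_self` contributes the same multiple of `contrDiff i i e`, so
the system of relations closes up into one equation. -/
theorem IsVacuum.diff_contrDiff_self (he : IsVacuum X n e) {i : Idx X n} (hi : (i : ℤ) ≤ 0)
    (ih : ∀ q < i, contrDiff q q e = 0) :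
    diff (contrDiff i i e) - X.kappa n • contrDiff i i e =
      diff (comm i i (-i) (-i) e) - X.kappa n • comm i i (-i) (-i) e -
        ((Finset.univ.filter (· < i)).card : ℂ) • contrDiff i i e := by
  nth_rw 1 2 [he.contrDiff_self i]
  have key : ∀ q ∈ Finset.univ.filter (· < i),
      diff (theta X i q • (comm q i (-q) (-i) e + comm i q (-i) (-q) e)) -
        X.kappa n • (theta X i q • (comm q i (-q) (-i) e + comm i q (-i) (-q) e)) =
      -contrDiff i i e := by
    intro q hq
    rw [Finset.mem_filter] at hq
    have hq' : (q : ℤ) < i := hq.2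
    have h1 := diff_comm_neg (he.perm_eq_zero (i := q) (l := -i)
      (by rw [← Subtype.coe_lt_coe, coe_neg_idx]; omega) i (-q))
    have h2 := diff_comm_neg (he.perm_eq_zero (i := i) (l := -q)
      (by rw [← Subtype.coe_lt_coe, coe_neg_idx]; omega) q (-i))
    -- `contrDiff j i` is a term in `j` minus a term in `i`, so the indices can be exchanged, and
    -- `contrDiff q q e` vanishes by hypothesis.
    have h3 : contrDiff i q e + contrDiff q i e = contrDiff i i e := by
      rw [← add_zero (contrDiff i i e), ← ih q hq.2]
      simp only [contrDiff]; abel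
    calc _ = theta X i q • ((diff (comm q i (-q) (-i) e) - X.kappa n • comm q i (-q) (-i) e) +
          (diff (comm i q (-i) (-q) e) - X.kappa n • comm i q (-i) (-q) e)) := by
          rw [map_smul, map_add]; module
      _ = -((theta X i q * theta X i q) • (contrDiff i q e + contrDiff q i e)) := by
          rw [h1, h2, theta_comm q i]; module
      _ = _ := by rw [theta_mul_self, one_smul, h3]
  have hsum := Finset.sum_congr rfl key
  rw [Finset.sum_sub_distrib, ← map_sum, ← Finset.smul_sum, Finset.sum_const,
    ← Nat.cast_smul_eq_nsmul ℂ] at hsum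
  rw [map_add, smul_add, add_sub_add_comm, hsum, smul_neg, ← sub_eq_add_neg]

/-- Since `i < -i`, `diff_comm_neg` turns the commutator term into `-contrDiff i i e`. The series is
then killed by `u - v - c` for a scalar `c`. -/
theorem IsVacuum.contrDiff_eq_zero (he : IsVacuum X n e) (i : Idx X n) (hi : (i : ℤ) < 0) :
    contrDiff i i e = 0 := by
  induction i using WellFoundedLT.induction with
  | ind i ih =>
    have h1 := he.diff_contrDiff_self hi.le fun q hq => ih q hq (lt_trans hq hi)
    rw [diff_comm_neg (he.perm_eq_zero (by rw [← Subtype.coe_lt_coe, coe_neg_idx]; omega) _ _),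
      theta_self] at h1
    refine eq_zero_of_diff_eq_smul (a := -1)
      (c := X.kappa n - 1 - ((Finset.univ.filter (· < i)).card : ℂ))
      (contrDiff_of_neg i i e) ?_
    rw [← sub_eq_zero] at h1 ⊢
    rw [← h1]; module

theorem IsVacuum.comm_neg_eq_zero (he : IsVacuum X n e) {i : Idx X n} (hi : (i : ℤ) ≤ 0) :
    comm i i (-i) (-i) e = 0 := by
  rcases hi.lt_or_eq with hi | hi
  · refine eq_zero_of_diff_eq_smul (c := X.kappa n) (comm_of_nonpos i i (-i) (-i) e) ?_
    rw [← sub_eq_zero, diff_comm_neg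
      (he.perm_eq_zero (by rw [← Subtype.coe_lt_coe, coe_neg_idx]; omega) _ _),
      he.contrDiff_eq_zero i hi, smul_zero]
  -- The index `0` is its own negative, so the permutation term is the commutator `C` itself instead
  -- of vanishing. Eliminating `C` leaves a quadratic equation in `u - v` for `G`.
  · have hn : -i = i := Subtype.ext (by rw [coe_neg_idx]; omega)
    have h1 := he.diff_contrDiff_self hi.le fun q hq => he.contrDiff_eq_zero q (by
      have : (q : ℤ) < i := hq
      omega)
    have h2 := diff_diff_comm_neg i i e
    have h3 : perm i i (-i) (-i) e = comm i i (-i) (-i) e := by rw [hn]; rfl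
    rw [h3, theta_self, one_smul] at h2
    set m := ((Finset.univ.filter (· < i)).card : ℂ)
    set C := comm i i (-i) (-i) e with hC
    set G := contrDiff i i e with hG
    have h4 : diff G = (X.kappa n - m) • G + diff C - X.kappa n • C := by
      rw [← sub_eq_zero] at h1 ⊢
      rw [← h1]; module
    have h5 : diff (diff G) = (X.kappa n - m) • diff G - (X.kappa n - m) • G := by
      have h6 : diff (diff G) =
          (X.kappa n - m) • diff G + (diff (diff C) - X.kappa n • diff C) := by
        conv_lhs => rw [h4]
        rw [map_sub, map_add, map_smul, map_smul]; abel
      rw [h6, h2]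
      nth_rw 2 [h4]
      module
    -- `z` is a square root of the discriminant of `x² - a x + a`, where `a = κ - m`, so the
    -- quadratic splits into two cancellable factors.
    obtain ⟨z, hz⟩ := IsAlgClosed.exists_eq_mul_self
      ((X.kappa n - m) ^ 2 - 4 * (X.kappa n - m))
    have hG0 : G = 0 := by
      refine eq_zero_of_diff_diff_eq (a := -1) (b := (X.kappa n - m + z) / 2)
        (c := (X.kappa n - m - z) / 2) (contrDiff_of_neg i i e) ?_
      rw [h5]
      congr 2
      · ring
      · linear_combination -(1 / 4 : ℂ) * hz
    refine eq_zero_of_diff_eq_smul (c := X.kappa n) (comm_of_nonpos i i (-i) (-i) e) ?_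
    rw [hG0, map_zero, smul_zero, zero_add] at h4
    exact (sub_eq_zero.mp h4.symm)

/-- The operators `t_{ii}(u)` commute on the vectors annihilated by all `t_{ij}(u)`, `i < j`. -/
theorem IsVacuum.comm_diagonal_eq_zero (he : IsVacuum X n e) (i k : Idx X n) :
    comm i i k k e = 0 := by
  wlog h : i ≤ k generalizing i k
  · ext r s
    rw [comm_swap, this k i (le_of_not_ge h)]
    simp
  by_cases hk : k = -i
  · subst hk
    refine he.comm_neg_eq_zero ?_
    have : (i : ℤ) ≤ ((-i : Idx X n) : ℤ) := h
    rw [coe_neg_idx] at this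
    omega
  · have h1 := diff_diff_comm i i k k e
    rw [if_neg hk, if_neg hk, sub_zero, map_zero, sub_zero] at h1
    -- For `i < k` the permutation term vanishes. For `i = k` it is the commutator again, which is
    -- then killed by `(u - v - κ)(u - v - 1)`.
    rcases h.lt_or_eq with h | rfl
    · rw [he.perm_eq_zero h, map_zero, smul_zero, sub_zero] at h1
      refine eq_zero_of_diff_diff_eq (b := X.kappa n) (c := 0) (comm_of_nonpos i i k k e) ?_
      rw [← sub_eq_zero, ← h1]; module
    · change _ = diff (comm i i i i e) - X.kappa n • comm i i i i e at h1
      refine eq_zero_of_diff_diff_eq (b := X.kappa n) (c := 1) (comm_of_nonpos i i i i e) ?_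
      rw [← sub_eq_zero] at h1 ⊢
      rw [← h1]; module

end Vacuum

/-! ### Simultaneous eigenvectors of commuting families. -/

section CommonEigenvector

variable {V : Type*} [AddCommGroup V] [Module ℂ V] [FiniteDimensional ℂ V]

/-- Induction on dimension: an operator not scalar on `W` has a proper nonzero eigenspace in `W`,
stable under the whole family. -/
theorem exists_common_eigenvector {ι : Type*} (f : ι → Module.End ℂ V) (W : Submodule ℂ V)
    (hW : W ≠ ⊥) (hf : ∀ i, ∀ v ∈ W, f i v ∈ W)
    (hc : ∀ i j, ∀ v ∈ W, f i (f j v) = f j (f i v)) :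
    ∃ v ∈ W, v ≠ 0 ∧ ∀ i, ∃ c : ℂ, f i v = c • v := by
  induction h : Module.finrank ℂ W using Nat.strong_induction_on generalizing W with
  | _ d ih =>
  by_cases hs : ∀ i, ∃ c : ℂ, ∀ v ∈ W, f i v = c • v
  · obtain ⟨v, hv, hv0⟩ := W.ne_bot_iff.mp hW
    exact ⟨v, hv, hv0, fun i => (hs i).imp fun c h => h v hv⟩
  · push Not at hs
    obtain ⟨i, hi⟩ := hs
    have : Nontrivial W := Submodule.nontrivial_iff_ne_bot.mpr hW
    obtain ⟨c, hμ⟩ := Module.End.exists_eigenvalue ((f i).restrict (hf i))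
    obtain ⟨w, hw⟩ := hμ.exists_hasEigenvector
    have hw1 : f i w = c • (w : V) := congrArg Subtype.val hw.apply_eq_smul
    have hw0 : (w : V) ≠ 0 := fun h0 => hw.2 (Subtype.ext h0)
    obtain ⟨v, hv, hvc⟩ := hi c
    have hlt : W ⊓ (f i).eigenspace c < W :=
      lt_of_le_of_ne inf_le_left fun heq => hvc (by
        rw [← heq] at hv
        exact Module.End.mem_eigenspace_iff.mp hv.2)
    obtain ⟨x, hx, hx'⟩ := ih _ (h ▸ Submodule.finrank_lt_finrank_of_lt hlt)
      (W ⊓ (f i).eigenspace c)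
      ((Submodule.ne_bot_iff _).mpr ⟨w, ⟨w.2, Module.End.mem_eigenspace_iff.mpr hw1⟩, hw0⟩)
      (fun j v hv => ⟨hf j v hv.1, Module.End.mem_eigenspace_iff.mpr (by
        rw [hc i j v hv.1, Module.End.mem_eigenspace_iff.mp hv.2, map_smul])⟩)
      (fun j k v hv => hc j k v hv.1) rfl
    exact ⟨x, hx.1, hx'⟩

end CommonEigenvector

/-! ### Existence of a highest vector, and almost commutativity. -/

section Highest

variable {X : ClassicalType} {n : ℕ} {V : Type*} [AddCommGroup V] [Module ℂ V]
  [Module (ExtendedYangian X n) V] [IsScalarTower ℂ (ExtendedYangian X n) V]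

theorem exists_vacuum_eigenspace [FiniteDimensional ℂ V] [Nontrivial V] :
    ∃ μ : ℂ, (grading X n V).eigenspace μ ≠ ⊥ ∧
      ∀ e ∈ (grading X n V).eigenspace μ, IsVacuum X n e := by
  obtain ⟨μ, hμ, hmax⟩ := Set.exists_max_image {μ | (grading X n V).HasEigenvalue μ} Complex.re
    (Module.End.finite_hasEigenvalue _) (Module.End.exists_eigenvalue (grading X n V))
  refine ⟨μ, hμ, fun e he i j hij r => ?_⟩
  by_contra h0
  -- A nonzero `t_{ij}^{(r)} e` would be an eigenvector whose eigenvalue has real part larger by `j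
  -- - i > 0`.
  have h := hmax (μ + (((j : ℤ) : ℂ) - ((i : ℤ) : ℂ))) (Module.End.hasEigenvalue_of_hasEigenvector
    ⟨Module.End.mem_eigenspace_iff.mpr
      (grading_op_of_eigen (Module.End.mem_eigenspace_iff.mp he) i j r), h0⟩)
  have hij' : ((i : ℤ) : ℝ) < ((j : ℤ) : ℝ) := Int.cast_lt.mpr hij
  simp only [Complex.add_re, Complex.sub_re, Complex.intCast_re] at h
  linarith

variable (X n V) in
theorem isHighestWeightModule_of_isSimpleModule [FiniteDimensional ℂ V]
    [IsSimpleModule (ExtendedYangian X n) V] : IsHighestWeightModule X n V := by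
  have : Nontrivial V := IsSimpleModule.nontrivial (ExtendedYangian X n) V
  obtain ⟨μ, hμ, hvac⟩ := exists_vacuum_eigenspace (X := X) (n := n) (V := V)
  obtain ⟨ξ, hξ, hξ0, hc⟩ := exists_common_eigenvector
    (fun p : Idx X n × ℤ => op X V p.1 p.1 p.2) _ hμ
    (fun p v hv => by
      rw [Module.End.mem_eigenspace_iff] at hv ⊢
      simpa using grading_op_of_eigen hv p.1 p.1 p.2)
    (fun p q v hv => sub_eq_zero.mp
      (congrFun (congrFun ((hvac v hv).comm_diagonal_eq_zero p.1 q.1) p.2) q.2))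
  choose c hc using hc
  refine ⟨ξ, fun i => PowerSeries.mk fun r => c (i, r), ⟨fun i => ?_, hξ0,
    IsSimpleModule.span_singleton_eq_top _ hξ0, fun i j hij r => ?_, fun i r => ?_⟩⟩
  · have h := hc (i, 0)
    rw [op_zero, if_pos rfl] at h
    rw [← PowerSeries.coeff_zero_eq_constantCoeff_apply, PowerSeries.coeff_mk, Nat.cast_zero]
    exact (smul_left_injective ℂ hξ0 (by simpa using h)).symm
  · rw [t_smul, hvac ξ hξ i j hij]
  · rw [t_smul, PowerSeries.coeff_mk]
    exact hc (i, r)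

/-- The span of the vectors `t_{ij}^{(a)} t_{kl}^{(b)} e` with `a + b ≤ N`. -/
def pairSpan (X : ClassicalType) (n : ℕ) {V : Type*} [AddCommGroup V] [Module ℂ V]
    [Module (ExtendedYangian X n) V] [IsScalarTower ℂ (ExtendedYangian X n) V]
    (e : V) (N : ℤ) : Submodule ℂ V :=
  Submodule.span ℂ {v | ∃ (i j k l : Idx X n) (a b : ℤ), a + b ≤ N ∧
    op X V i j a (op X V k l b e) = v}

theorem pairSpan_mono (e : V) : Monotone (pairSpan X n e) := fun _ _ h =>
  Submodule.span_mono fun _ ⟨i, j, k, l, a, b, hab, hv⟩ => ⟨i, j, k, l, a, b, hab.trans h, hv⟩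

theorem op_op_mem_pairSpan (e : V) (i j k l : Idx X n) {a b N : ℤ} (h : a + b ≤ N) :
    op X V i j a (op X V k l b e) ∈ pairSpan X n e N :=
  Submodule.subset_span ⟨i, j, k, l, a, b, h, rfl⟩

/-- The algebra is almost commutative for the filtration with `t_{ij}^{(r)}` of degree `r`. -/
theorem comm_mem_pairSpan (i j k l : Idx X n) (e : V) (r s : ℤ) :
    comm i j k l e r s ∈ pairSpan X n e (r + s - 1) := by
  have hm : ∀ a : ℤ, Monotone fun N => pairSpan X n e (N + a) := fun a _ _ h =>
    pairSpan_mono e (by simpa using h)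
  have hP : ∀ r s, perm i j k l e r s ∈ pairSpan X n e (r + s) := fun r s =>
    sub_mem (op_op_mem_pairSpan e _ _ _ _ le_rfl) (op_op_mem_pairSpan e _ _ _ _ (by omega))
  have hQ : ∀ r s, ((if k = -i then contrLeft i j l e else 0) -
      (if l = -j then contrRight j i k e else 0)) r s ∈ pairSpan X n e (r + s) := fun r s => by
    refine sub_mem ?_ ?_
    · split_ifs
      · exact sum_mem fun p _ => Submodule.smul_mem _ _ (op_op_mem_pairSpan e _ _ _ _ le_rfl)
      · exact zero_mem _
    · split_ifs
      · exact sum_mem fun p _ => Submodule.smul_mem _ _ (op_op_mem_pairSpan e _ _ _ _ (by omega))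
      · exact zero_mem _
  have hD : ∀ {F : ℤ → ℤ → V}, (∀ r s, F r s ∈ pairSpan X n e (r + s)) →
      ∀ r s, diff F r s ∈ pairSpan X n e (r + s + 1) := fun hF r s => by
    refine sub_mem ?_ ?_
    · rw [show r + s + 1 = r + 1 + s by ring]; exact hF _ _
    · rw [show r + s + 1 = r + (s + 1) by ring]; exact hF _ _
  -- The two factors are cancelled one at a time, `u - v` here and `u - v - κ` at the end; each
  -- lowers the filtration degree by one.
  have h1 : ∀ r s, (diff (comm i j k l e) - X.kappa n • comm i j k l e) r s ∈
      pairSpan X n e (r + s) := by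
    intro r s
    refine mem_of_diff_sub_smul_mem (c := 0) (S := pairSpan X n e) (pairSpan_mono e)
      (a := -1) (fun r s hr => ?_) (fun r s => ?_) r s
    · rw [Pi.sub_apply, Pi.sub_apply, Pi.smul_apply, Pi.smul_apply,
        diff_eq_zero_of_le (comm_of_nonpos i j k l e) r s (by omega),
        comm_of_nonpos _ _ _ _ _ _ _ (by omega), smul_zero, sub_zero]
    · rw [zero_smul, sub_zero, map_sub, map_smul, diff_diff_comm]
      exact sub_mem (sub_mem (hD hP r s)
        (Submodule.smul_mem _ _ (pairSpan_mono e (by omega) (hP r s)))) (hD hQ r s)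
  refine mem_of_diff_sub_smul_mem (S := fun N => pairSpan X n e (N - 1)) (hm (-1))
    (comm_of_nonpos i j k l e) (c := X.kappa n) (fun r s => ?_) r s
  simpa using h1 r s

/-! ### Spanning by lowered vectors. -/

variable (X n) in
/-- The vectors obtained from `ξ` by applying coefficients of series `t_{ij}(u)` with `j < i`,
of total degree at most `d`. -/
inductive Lowered (ξ : V) : ℤ → V → Prop
  | base {d : ℤ} : 0 ≤ d → Lowered ξ d ξ
  | step {i j : Idx X n} {r d d' : ℤ} {w : V} : j < i → 1 ≤ r → Lowered ξ d w → d + r ≤ d' →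
      Lowered ξ d' (op X V i j r w)

variable (X n) in
/-- The span of the lowered vectors of degree at most `d`. -/
def loweredSpan (ξ : V) (d : ℤ) : Submodule ℂ V := Submodule.span ℂ {w | Lowered X n ξ d w}

variable {ξ : V}

theorem Lowered.nonneg {d : ℤ} {w : V} (h : Lowered X n ξ d w) : 0 ≤ d := by
  induction h with
  | base h => exact h
  | step _ _ _ _ ih => omega

theorem Lowered.mono {d d' : ℤ} {w : V} (h : Lowered X n ξ d w) (hd : d ≤ d') :
    Lowered X n ξ d' w := by
  cases h with
  | base h => exact .base (h.trans hd)
  | step h1 h2 h3 h4 => exact .step h1 h2 h3 (h4.trans hd)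

theorem loweredSpan_mono : Monotone (loweredSpan X n ξ) := fun _ _ h =>
  Submodule.span_mono fun _ hw => Lowered.mono hw h

/-- Reordering by induction on total degree: a coefficient that is not lowering is moved right past
the lowering ones until it meets `ξ`, and each commutator has strictly smaller total degree. -/
theorem op_mem_loweredSpan_of_lt (hξ : ∀ i j : Idx X n, i ≤ j → ∀ r : ℤ, ∃ c : ℂ,
    op X V i j r ξ = c • ξ) (N : ℕ) (i j : Idx X n) (r d : ℤ) (hN : r + d < N) :
    ∀ w ∈ loweredSpan X n ξ d, op X V i j r w ∈ loweredSpan X n ξ (d + r) := by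
  induction N generalizing i j r d with
  | zero =>
    intro w hw
    induction hw using Submodule.span_induction with
    | mem w hw =>
      have := Lowered.nonneg hw
      rw [op_of_neg i j (show r < 0 by simp at hN; omega)]; exact zero_mem _
    | zero => rw [map_zero]; exact zero_mem _
    | add x y _ _ hx hy => rw [map_add]; exact add_mem hx hy
    | smul c x _ hx => rw [map_smul]; exact Submodule.smul_mem _ _ hx
  | succ N ih =>
    intro w hw
    induction hw using Submodule.span_induction with
    | zero => rw [map_zero]; exact zero_mem _
    | add x y _ _ hx hy => rw [map_add]; exact add_mem hx hy
    | smul c x _ hx => rw [map_smul]; exact Submodule.smul_mem _ _ hx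
    | mem w hw =>
      rcases lt_trichotomy r 0 with hr | rfl | hr
      · rw [op_of_neg i j hr]; exact zero_mem _
      · rw [op_zero]
        split_ifs
        · exact Submodule.subset_span (hw.mono (by omega))
        · exact zero_mem _
      rcases lt_or_ge j i with hij | hij
      · exact Submodule.subset_span (Lowered.step hij hr hw le_rfl)
      cases hw with
      | base hd =>
        obtain ⟨c, hc⟩ := hξ i j hij r
        rw [hc]
        exact Submodule.smul_mem _ _ (Submodule.subset_span (.base (by omega)))
      | @step k l s d₁ _ w hlk hs hw hd =>
        have hw' : w ∈ loweredSpan X n ξ d₁ := Submodule.subset_span hw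
        have h1 : op X V i j r w ∈ loweredSpan X n ξ (d₁ + r) :=
          ih i j r d₁ (by push_cast at hN; omega) w hw'
        have h2 : op X V k l s (op X V i j r w) ∈ loweredSpan X n ξ (d₁ + r + s) := by
          refine Submodule.span_induction (p := fun v _ => op X V k l s v ∈
            loweredSpan X n ξ (d₁ + r + s)) (fun v hv => ?_) ?_ (fun x y _ _ hx hy => ?_)
            (fun c x _ hx => ?_) h1
          · exact Submodule.subset_span (Lowered.step hlk hs hv le_rfl)
          · rw [map_zero]; exact zero_mem _
          · rw [map_add]; exact add_mem hx hy
          · rw [map_smul]; exact Submodule.smul_mem _ _ hx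
        have h3 : pairSpan X n w (r + s - 1) ≤ loweredSpan X n ξ (d + r) := by
          refine Submodule.span_le.mpr ?_
          rintro _ ⟨i', j', k', l', a, b, hab, rfl⟩
          -- Only `a + b` is bounded, so `a ≥ 0` is needed to bound `b` before the inductive
          -- hypothesis applies to the inner factor.
          rcases lt_or_ge a 0 with ha | ha
          · rw [op_of_neg _ _ ha]; exact zero_mem _
          push_cast at hN
          have h4 := ih k' l' b d₁ (by omega) w hw'
          exact loweredSpan_mono (by omega) (ih i' j' a (d₁ + b) (by omega) _ h4)
        have h5 := h3 (comm_mem_pairSpan i j k l w r s)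
        have h6 := add_mem h5 (loweredSpan_mono (show d₁ + r + s ≤ d + r by omega) h2)
        simpa [comm] using h6

theorem op_mem_loweredSpan (hξ : ∀ i j : Idx X n, i ≤ j → ∀ r : ℤ, ∃ c : ℂ,
    op X V i j r ξ = c • ξ) (i j : Idx X n) (r d : ℤ) {w : V} (hw : w ∈ loweredSpan X n ξ d) :
    op X V i j r w ∈ loweredSpan X n ξ (d + r) :=
  op_mem_loweredSpan_of_lt hξ ((r + d).toNat + 1) i j r d (by push_cast; omega) w hw

theorem smul_mem_of_op_mem {W : Submodule ℂ V}
    (hW : ∀ (i j : Idx X n) (r : ℤ), ∀ w ∈ W, op X V i j r w ∈ W)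
    (x : ExtendedYangian X n) {w : V} (hw : w ∈ W) : x • w ∈ W := by
  obtain ⟨x, rfl⟩ := RingQuot.mkAlgHom_surjective ℂ (Rel X n) x
  induction x using FreeAlgebra.induction generalizing w with
  | grade0 c =>
    rw [AlgHom.commutes, algebraMap_smul]
    exact W.smul_mem c hw
  | grade1 p => exact hW p.1 p.2.1 (p.2.2 + 1 : ℕ) w hw
  | mul a b ha hb =>
    rw [map_mul, mul_smul]
    exact ha (hb hw)
  | add a b ha hb =>
    rw [map_add, add_smul]
    exact add_mem (ha hw) (hb hw)

theorem iSup_loweredSpan_eq_top (hξ : ∀ i j : Idx X n, i ≤ j → ∀ r : ℤ, ∃ c : ℂ,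
    op X V i j r ξ = c • ξ) (hgen : Submodule.span (ExtendedYangian X n) {ξ} = ⊤) :
    ⨆ d, loweredSpan X n ξ d = ⊤ := by
  refine eq_top_iff.mpr fun v _ => ?_
  have hv : v ∈ Submodule.span (ExtendedYangian X n) {ξ} := hgen ▸ Submodule.mem_top
  obtain ⟨x, rfl⟩ := Submodule.mem_span_singleton.mp hv
  refine smul_mem_of_op_mem (fun i j r w hw => ?_) x
    (Submodule.mem_iSup_of_mem 0 (Submodule.subset_span (.base le_rfl)))
  obtain ⟨d, hd⟩ := (Submodule.mem_iSup_of_directed _ loweredSpan_mono.directed_le).mp hw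
  exact Submodule.mem_iSup_of_mem _ (op_mem_loweredSpan hξ i j r d hd)

theorem Lowered.eq_or_grading {μ : ℂ} (hμ : grading X n V ξ = μ • ξ) {d : ℤ} {w : V}
    (h : Lowered X n ξ d w) :
    w = ξ ∨ ∃ m : ℕ, grading X n V w = (μ - (m + 1 : ℕ)) • w := by
  suffices w = ξ ∧ grading X n V w = μ • w ∨
      ∃ m : ℕ, grading X n V w = (μ - (m + 1 : ℕ)) • w from this.imp_left And.left
  induction h with
  | base _ => exact .inl ⟨rfl, hμ⟩
  | @step i j r _ _ w hji _ _ _ ih =>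
    have hji' : (j : ℤ) < i := hji
    obtain ⟨m, hm⟩ : ∃ m : ℕ, grading X n V w = (μ - m) • w := by
      rcases ih with ⟨_, h⟩ | ⟨m, h⟩
      · exact ⟨0, by simpa using h⟩
      · exact ⟨m + 1, h⟩
    obtain ⟨p, hp⟩ := Int.le.dest (show (j : ℤ) + 1 ≤ i by omega)
    refine .inr ⟨m + p, ?_⟩
    rw [grading_op_of_eigen hm, ← hp]
    congr 1
    push_cast
    ring

/-! ### Uniqueness of the highest vector. -/

namespace IsHighestVectorOfWeight

variable {lam : Idx X n → PowerSeries ℂ}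

theorem exists_op_eq_smul (h : IsHighestVectorOfWeight lam ξ) (i j : Idx X n) (hij : i ≤ j)
    (r : ℤ) : ∃ c : ℂ, op X V i j r ξ = c • ξ := by
  rcases lt_or_ge r 0 with hr | hr
  · exact ⟨0, by simp [op_of_neg i j hr]⟩
  lift r to ℕ using hr
  rcases hij.lt_or_eq with hij | rfl
  · exact ⟨0, by rw [← t_smul, h.raising i j hij, zero_smul]⟩
  · exact ⟨_, (t_smul i i r ξ).symm.trans (h.diagonal i r)⟩

theorem exists_grading_eq_smul (h : IsHighestVectorOfWeight lam ξ) :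
    ∃ μ : ℂ, grading X n V ξ = μ • ξ := by
  choose c hc using fun i : Idx X n => h.exists_op_eq_smul i i le_rfl 1
  exact ⟨∑ i : Idx X n, -((i : ℤ) : ℂ) / 2 * c i, by
    simp [grading, hc, Finset.sum_smul, mul_smul]⟩

/-- The weights of a highest weight module lie below the highest one, whose weight space is
spanned by the highest vector. -/
theorem span_sup_iSup_eigenspace (h : IsHighestVectorOfWeight lam ξ) {μ : ℂ}
    (hμ : grading X n V ξ = μ • ξ) :
    Submodule.span ℂ {ξ} ⊔ ⨆ m : ℕ, (grading X n V).eigenspace (μ - (m + 1 : ℕ)) = ⊤ := by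
  rw [eq_top_iff, ← iSup_loweredSpan_eq_top h.exists_op_eq_smul h.generates]
  refine iSup_le fun d => Submodule.span_le.mpr fun w hw => ?_
  rcases Lowered.eq_or_grading hμ hw with rfl | ⟨m, hm⟩
  · exact Submodule.mem_sup_left (Submodule.mem_span_singleton_self _)
  · exact Submodule.mem_sup_right (Submodule.mem_iSup_of_mem m
      (Module.End.mem_eigenspace_iff.mpr hm))

/-- Eigenspaces are independent, so an eigenvalue outside `μ - ℕ` would have an eigenspace disjoint
from the whole module. -/
theorem exists_eq_sub_natCast (h : IsHighestVectorOfWeight lam ξ) {μ ν : ℂ}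
    (hμ : grading X n V ξ = μ • ξ) {η : V} (hη : grading X n V η = ν • η) (hη0 : η ≠ 0) :
    ∃ m : ℕ, ν = μ - m := by
  by_contra! hne
  have hd := (Module.End.eigenspaces_iSupIndep (grading X n V)) ν
  have htop : ⨆ (a : ℂ) (_ : a ≠ ν), (grading X n V).eigenspace a = ⊤ := by
    rw [eq_top_iff, ← h.span_sup_iSup_eigenspace hμ]
    refine sup_le ?_ (iSup_le fun m => le_iSup₂_of_le _ (hne (m + 1)).symm le_rfl)
    refine le_iSup₂_of_le μ (by simpa using (hne 0).symm) ?_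
    rw [Submodule.span_singleton_le_iff_mem]
    exact Module.End.mem_eigenspace_iff.mpr hμ
  rw [htop, disjoint_top] at hd
  exact hη0 ((Submodule.mem_bot ℂ).mp (hd ▸ Module.End.mem_eigenspace_iff.mpr hη))

theorem exists_eq_smul (h : IsHighestVectorOfWeight lam ξ) {lam' : Idx X n → PowerSeries ℂ}
    {η : V} (h' : IsHighestVectorOfWeight lam' η) : ∃ c : ℂ, c ≠ 0 ∧ η = c • ξ := by
  obtain ⟨μ, hμ⟩ := h.exists_grading_eq_smul
  obtain ⟨ν, hν⟩ := h'.exists_grading_eq_smul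
  obtain ⟨m, hm⟩ := h.exists_eq_sub_natCast hμ hν h'.ne_zero
  obtain ⟨m', hm'⟩ := h'.exists_eq_sub_natCast hν hμ h.ne_zero
  have hmm : ((m + m' : ℕ) : ℂ) = 0 := by push_cast; linear_combination hm + hm'
  obtain rfl : m = 0 := by have := Nat.cast_eq_zero.mp hmm; omega
  obtain rfl : ν = μ := by simpa using hm
  have hmem : η ∈ Submodule.span ℂ {ξ} ⊔
      ⨆ m : ℕ, (grading X n V).eigenspace (ν - (m + 1 : ℕ)) :=
    (h.span_sup_iSup_eigenspace hμ) ▸ Submodule.mem_top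
  obtain ⟨x, hx, y, hy, rfl⟩ := Submodule.mem_sup.mp hmem
  obtain ⟨c, rfl⟩ := Submodule.mem_span_singleton.mp hx
  have hle : ⨆ m : ℕ, (grading X n V).eigenspace (ν - (m + 1 : ℕ)) ≤
      ⨆ (a : ℂ) (_ : a ≠ ν), (grading X n V).eigenspace a :=
    iSup_le fun m => le_iSup₂_of_le _ (fun h => Nat.cast_add_one_ne_zero (R := ℂ) m
      (by push_cast at h; linear_combination -h)) le_rfl
  -- Both `c • ξ + y` and `ξ` have degree `ν`, hence so does `y`, which also lies in the sum of the
  -- other eigenspaces.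
  have hy' : y ∈ (grading X n V).eigenspace ν := by
    rw [Module.End.mem_eigenspace_iff]
    rw [map_add, map_smul, hμ, smul_add, smul_comm] at hν
    exact add_left_cancel hν
  have hy0 : y = 0 := Submodule.disjoint_def.mp
    ((Module.End.eigenspaces_iSupIndep (grading X n V)) ν) y hy' (hle hy)
  refine ⟨c, ?_, by rw [hy0, add_zero]⟩
  rintro rfl
  exact h'.ne_zero (by rw [hy0, zero_smul, add_zero])

end IsHighestVectorOfWeight

end Highest

end ExtYangian

end

theorem theorem5p1 (X : ExtYangian.ClassicalType) (n : ℕ) (hn : X.Admissible n)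
    (V : Type*) [AddCommGroup V] [Module ℂ V] [Module (ExtYangian.ExtendedYangian X n) V]
    [IsScalarTower ℂ (ExtYangian.ExtendedYangian X n) V]
    [FiniteDimensional ℂ V] [IsSimpleModule (ExtYangian.ExtendedYangian X n) V] :
    ExtYangian.IsHighestWeightModule X n V ∧
      ∀ ξ η : V, ExtYangian.IsHighestVector X n ξ → ExtYangian.IsHighestVector X n η →
        ∃ c : ℂ, c ≠ 0 ∧ η = c • ξ :=
  ⟨ExtYangian.isHighestWeightModule_of_isSimpleModule X n V,
    fun _ _ ⟨_, hξ⟩ ⟨_, hη⟩ => hξ.exists_eq_smul hη⟩
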